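/- Let $k$ be a field of characteristic $p>0$ and let $P$ be a finite partially ordered set. Let $J(P)$ be the set of poset ideals (down-closed subsets) of $P$, and let $$R=k\Big[\,T\prod_{x\in I}X_x \;\Big|\; I\in J(P)\Big]\subseteq k[T,\,X_x \mid x\in P]$$ be the Hibi ring of $J(P)$, graded by the degree in $T$, with homogeneous maximal ideal $\mathfrak m=R_+$ generated by the monomials $T\prod_{x\in I}X_x$, $I\in J(P)$. For a real number $t\ge 0$ the pair $(R,\mathfrak m^t)$ is called F-pure if for all large $q=p^e$ there is an element $d\in\mathfrak m^{\lceil t(q-1)\rceil}$ such that the $R$-linear map $R\to R^{1/q}$, $1\mapsto d^{1/q}$, splits. The F-pure threshold of $\mathfrak m$ is $$\operatorname{fpt}(\mathfrak m)=\sup\{t\in\mathbb R_{\ge 0} \mid (R,\mathfrak m^t)\text{ is F-pure}\}.$$ Let $\overline P=P\cup\{-\infty,\infty\}$ be $P$ with a new least element $-\infty$ and a new greatest element $\infty$. A chain is a totally ordered subset, and the length of a chain $C$ is $\operatorname{length}(C)=\#C-1$ (so if $P=\emptyset$, its only maximal chain is $\emptyset$, of length $-1$). Then $\operatorname{fpt}(\mathfrak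 m)$ is a (finite) real number, and $$\operatorname{fpt}(\mathfrak m)\ \le\ \min\{\operatorname{length}(C) \mid C \text{ a maximal chain of } \overline P\}\ =\ \min\{\operatorname{length}(C)\mid C\text{ a maximal chain of }P\}+2 .$$ -/

import Mathlib

noncomputable section

/-! ### F-purity of pairs and the F-pure threshold -/

/-- The `R`-algebra `R^{1/q}`, `q = p ^ e`, for a ring `R` of characteristic `p`. It is realised on a
copy of the ring `R`, whose element `d` stands for the root `d^{1/q}`; since `r = (r^q)^{1/q}`,
the structure map `R → R^{1/q}` is the `e`-th iterate of the Frobenius map. -/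
def FrobeniusRoot (R : Type*) (_p _e : ℕ) : Type _ := R

instance (R : Type*) [CommRing R] (p e : ℕ) : CommRing (FrobeniusRoot R p e) :=
  inferInstanceAs (CommRing R)

/-- The ring isomorphism `R ≃ R^{1/q}`, `d ↦ d^{1/q}`. -/
def FrobeniusRoot.root (R : Type*) [CommRing R] (p e : ℕ) : R ≃+* FrobeniusRoot R p e :=
  RingEquiv.refl R

instance (R : Type*) [CommRing R] (p e : ℕ) [ExpChar R p] : Algebra R (FrobeniusRoot R p e) :=
  ((FrobeniusRoot.root R p e : R →+* FrobeniusRoot R p e).comp (iterateFrobenius R p e)).toAlgebra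

/-- In `R^{1/q}` one has `(d^{1/q})^q = d`. -/
theorem FrobeniusRoot.root_pow (R : Type*) [CommRing R] (p e : ℕ) [ExpChar R p] (d : R) :
    FrobeniusRoot.root R p e d ^ p ^ e = algebraMap R (FrobeniusRoot R p e) d := by
  rw [← map_pow]
  rfl

/-- The `R`-linear map `R → R^{1/q}`, `1 ↦ d^{1/q}`, splits. -/
def RootMapSplits (R : Type*) [CommRing R] (p e : ℕ) [ExpChar R p] (d : R) : Prop :=
  ∃ φ : FrobeniusRoot R p e →ₗ[R] R,
    φ ∘ₗ LinearMap.toSpanSingleton R (FrobeniusRoot R p e) (FrobeniusRoot.root R p e d) =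
      LinearMap.id

/-- The pair `(R, 𝔞^t)` is F-pure: for all large `q = p ^ e` there is `d ∈ 𝔞^⌈t(q-1)⌉` such that
`R → R^{1/q}`, `1 ↦ d^{1/q}`, splits. Used for `t ≥ 0` only. -/
def IsFPurePair {R : Type*} [CommRing R] (p : ℕ) [ExpChar R p] (𝔞 : Ideal R) (t : ℝ) : Prop :=
  ∃ e₀ : ℕ, ∀ e ≥ e₀, ∃ d ∈ 𝔞 ^ ⌈t * ((p : ℝ) ^ e - 1)⌉₊, RootMapSplits R p e d

/-- The set of real numbers `t ≥ 0` such that `(R, 𝔞^t)` is F-pure. -/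
def fPureExponents {R : Type*} [CommRing R] (p : ℕ) [ExpChar R p] (𝔞 : Ideal R) : Set ℝ :=
  {t | 0 ≤ t ∧ IsFPurePair p 𝔞 t}

/-- The F-pure threshold of `𝔞`. -/
def fpt {R : Type*} [CommRing R] (p : ℕ) [ExpChar R p] (𝔞 : Ideal R) : ℝ :=
  sSup (fPureExponents p 𝔞)

/-! ### Hibi rings -/

open Classical in
/-- The monomial `T * ∏_{x ∈ I} X_x` of a poset ideal `I`. The variables are indexed by
`Option P`: `none` is the index of `T`, and `some x` is the index of `X_x`. -/
def hibiMonomial (k P : Type*) [Field k] [PartialOrder P] [Fintype P] (I : LowerSet P) :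
    MvPolynomial (Option P) k :=
  MvPolynomial.X none * ∏ x ∈ Finset.univ.filter (· ∈ I), MvPolynomial.X (some x)

/-- The Hibi ring over `k` of the distributive lattice `J(P)` of poset ideals of `P`. -/
abbrev HibiRing (k P : Type*) [Field k] [PartialOrder P] [Fintype P] :
    Subalgebra k (MvPolynomial (Option P) k) :=
  Algebra.adjoin k (Set.range (hibiMonomial k P))

instance (k P : Type*) [Field k] [PartialOrder P] [Fintype P] (p : ℕ) [ExpChar k p] :
    ExpChar (HibiRing k P) p :=
  expChar_of_injective_algebraMap (algebraMap k (HibiRing k P)).injective p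

/-- The algebra generator of the Hibi ring that belongs to the poset ideal `I`. -/
def hibiGenerator (k P : Type*) [Field k] [PartialOrder P] [Fintype P] (I : LowerSet P) :
    HibiRing k P :=
  ⟨hibiMonomial k P I, Algebra.subset_adjoin ⟨I, rfl⟩⟩

/-- The homogeneous maximal ideal `𝔪 = R₊` of the Hibi ring `R`, which is graded by the degree
in `T`. As `R` is generated over `k` in degree one, `𝔪` is generated by the algebra generators. -/
def hibiMaximalIdeal (k P : Type*) [Field k] [PartialOrder P] [Fintype P] :
    Ideal (HibiRing k P) :=
  Ideal.span (Set.range (hibiGenerator k P))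

/-! ### Maximal chains -/

/-- The set of the lengths `#C - 1` of the maximal chains `C` of a poset. (The only maximal chain
of the empty poset is the empty one; its length is `-1`.) -/
def maximalChainLengths (Q : Type*) [PartialOrder Q] : Set ℤ :=
  {l | ∃ C : Set Q, IsMaxChain (· ≤ ·) C ∧ l = (C.ncard : ℤ) - 1}

/-- The poset `P ∪ {-∞, ∞}`, where `-∞` and `∞` are new least and greatest elements. -/
abbrev ExtendedPoset (P : Type*) : Type _ := WithBot (WithTop P)

end

/-! The Hibi ring is the semigroup ring of the cone of order-reversing vectors on `P ∪ {-∞, ∞}` that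
vanish at `∞`; the value at `-∞` is the degree in `T`. The facets of the cone correspond to the
covers `x ⋖ y`, with functional `a x - a y`.

Put `q = p ^ e`. If `1 ↦ d^{1/q}` splits, a `q⁻¹`-linear map `ψ` sends `d` to `1`, so some monomial
of `d`, with exponent `a`, has an image with nonzero constant term. Then `a x - a y ≤ q - 1` for
every cover (`extVal_le_of_coeff_zero_ne_zero`). Summing along a maximal chain `C` bounds the
`T`-degree of `a` by `length(C) * (q - 1)` (`IsMaxChain.le_ncard_sub_one_mul`). That degree is at
least `⌈t(q-1)⌉`, as `d` lies in this power of `𝔪`; hence `t ≤ length(C)`. F-purity of `R` itself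
makes the set of exponents nonempty, so its supremum is a genuine one. -/

noncomputable section

open MvPolynomial

/-! ### Exponent vectors and the cone -/

section Exponents

variable {P : Type*}

/-- The extension of an exponent vector to `P ∪ {-∞, ∞}`: the value at `-∞` is the exponent of `T`,
the value at `∞` is zero. -/
def extVal (a : Option P →₀ ℕ) : ExtendedPoset P → ℕ :=
  WithBot.recBotCoe (a none) (WithTop.recTopCoe 0 fun x => a (some x))

@[simp] theorem extVal_bot (a : Option P →₀ ℕ) : extVal a ⊥ = a none := rfl

@[simp] theorem extVal_top (a : Option P →₀ ℕ) : extVal a ⊤ = 0 := rfl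

@[simp] theorem extVal_coe (a : Option P →₀ ℕ) (x : P) :
    extVal a ((x : WithTop P) : ExtendedPoset P) = a (some x) := rfl

theorem extendedPoset_cases {motive : ExtendedPoset P → Prop} (bot : motive ⊥) (top : motive ⊤)
    (coe : ∀ x : P, motive ((x : WithTop P) : ExtendedPoset P)) (z : ExtendedPoset P) :
    motive z := by
  induction z using WithBot.recBotCoe with
  | bot => exact bot
  | coe z =>
    induction z using WithTop.recTopCoe with
    | top => exact top
    | coe x => exact coe x

theorem extVal_zero (z : ExtendedPoset P) : extVal (0 : Option P →₀ ℕ) z = 0 := by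
  induction z using extendedPoset_cases <;> simp

theorem extVal_add (a b : Option P →₀ ℕ) (z : ExtendedPoset P) :
    extVal (a + b) z = extVal a z + extVal b z := by
  induction z using extendedPoset_cases <;> simp

theorem extVal_nsmul (n : ℕ) (a : Option P →₀ ℕ) (z : ExtendedPoset P) :
    extVal (n • a) z = n * extVal a z := by
  induction z using extendedPoset_cases <;> simp

theorem extVal_injective : Function.Injective (extVal : (Option P →₀ ℕ) → _) := by
  intro a b h
  ext o
  cases o with
  | none => exact congrFun h ⊥
  | some x => exact congrFun h ((x : WithTop P) : ExtendedPoset P)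

theorem exists_extVal_eq [Finite P] (v : ExtendedPoset P → ℕ) (hv : v ⊤ = 0) :
    ∃ a : Option P →₀ ℕ, extVal a = v := by
  refine ⟨Finsupp.equivFunOnFinite.symm
    fun o => o.elim (v ⊥) fun x => v ((x : WithTop P) : ExtendedPoset P), ?_⟩
  funext z
  induction z using extendedPoset_cases <;> simp [hv]

variable [PartialOrder P]

variable (P) in
/-- The monoid of the exponent vectors of the monomials in the Hibi ring. -/
def hibiCone : AddSubmonoid (Option P →₀ ℕ) where
  carrier := {a | Antitone (extVal a)}
  zero_mem' := fun z w _ => by simp [extVal_zero]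
  add_mem' := fun ha hb z w h => by
    simpa only [extVal_add] using add_le_add (ha h) (hb h)

/-- Saturation of the cone, which lets the splitting of Frobenius on polynomials restrict to the
Hibi ring. -/
theorem mem_hibiCone_of_nsmul {n : ℕ} (hn : 0 < n) {a : Option P →₀ ℕ}
    (h : n • a ∈ hibiCone P) : a ∈ hibiCone P := by
  intro z w hzw
  have := h hzw
  rw [extVal_nsmul, extVal_nsmul] at this
  exact Nat.le_of_mul_le_mul_left this hn

end Exponents

/-! ### The Hibi ring as a semigroup ring -/

section HibiRing

variable {k P : Type*} [Field k] [PartialOrder P] [Fintype P]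

open Classical in
theorem exists_hibiMonomial_eq (k : Type*) [Field k] (I : LowerSet P) :
    ∃ a : Option P →₀ ℕ, hibiMonomial k P I = monomial a 1 ∧ a none = 1 ∧
      ∀ x, a (some x) = if x ∈ I then 1 else 0 := by
  refine ⟨Finsupp.single none 1 + ∑ x ∈ Finset.univ.filter (· ∈ I), Finsupp.single (some x) 1,
    ?_, ?_, fun x => ?_⟩
  · rw [hibiMonomial, ← one_mul (1 : k), ← monomial_mul, monomial_sum_one]
    rfl
  · simp
  · simp [Finsupp.single_apply]

theorem monomial_mem_hibiRing {a : Option P →₀ ℕ} (ha : a ∈ hibiCone P) (c : k) :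
    monomial a c ∈ HibiRing k P := by
  classical
  suffices h : ∀ n : ℕ, ∀ a ∈ hibiCone P, a none = n → monomial a (1 : k) ∈ HibiRing k P by
    have := (HibiRing k P).smul_mem (h _ a ha rfl) c
    rwa [smul_monomial, smul_eq_mul, mul_one] at this
  clear ha a
  intro n
  induction n with
  | zero =>
    intro a ha h0
    have : a = 0 := by
      apply extVal_injective
      funext z
      have := ha (bot_le : ⊥ ≤ z)
      rw [extVal_bot, h0] at this
      rw [extVal_zero]
      omega
    rw [this]
    exact one_mem _
  | succ n ih =>
    intro a ha h0
    -- Truncated subtraction lowers `a` by one exactly on its support, so it peels off the generator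
    -- of the ideal `{x | 1 ≤ a x}`.
    obtain ⟨b, hb⟩ := exists_extVal_eq (fun z => extVal a z - 1) (by simp)
    have hb' : ∀ z, extVal b z = extVal a z - 1 := fun z => congrFun hb z
    let I : LowerSet P := ⟨{x | 1 ≤ a (some x)}, fun x y hyx hx => by
      have := ha (show ((y : WithTop P) : ExtendedPoset P) ≤ ((x : WithTop P) : ExtendedPoset P) by
        simpa using hyx)
      simp only [extVal_coe] at this
      exact le_trans hx this⟩
    obtain ⟨g, hg, hg0, hgx⟩ := exists_hibiMonomial_eq k I
    have hab : a = g + b := by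
      apply extVal_injective
      funext z
      rw [extVal_add, hb']
      induction z using extendedPoset_cases with
      | bot => simp only [extVal_bot, hg0]; omega
      | top => simp
      | coe x =>
        simp only [extVal_coe, hgx]
        split_ifs with hx
        · have : 1 ≤ a (some x) := hx
          omega
        · have : ¬ 1 ≤ a (some x) := hx
          omega
    have hbc : b ∈ hibiCone P := fun z w h => by
      rw [hb', hb']
      exact Nat.sub_le_sub_right (ha h) 1
    have hbn : b none = n := by
      have := hb' ⊥
      simp only [extVal_bot] at this
      omega
    rw [hab, ← mul_one (1 : k), ← monomial_mul, ← hg]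
    exact mul_mem (Algebra.subset_adjoin ⟨I, rfl⟩) (ih b hbc hbn)

theorem mem_hibiRing_iff {f : MvPolynomial (Option P) k} :
    f ∈ HibiRing k P ↔ ∀ a, coeff a f ≠ 0 → a ∈ hibiCone P := by
  classical
  constructor
  · intro hf
    suffices h : ∀ a ∈ f.support, a ∈ hibiCone P from fun a ha => h a (mem_support_iff.2 ha)
    induction hf using Algebra.adjoin_induction with
    | mem f hf =>
      obtain ⟨I, rfl⟩ := hf
      obtain ⟨g, hg, hg0, hgx⟩ := exists_hibiMonomial_eq k I
      intro a ha
      rw [hg] at ha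
      obtain rfl := Finset.mem_singleton.1 (support_monomial_subset ha)
      intro z w hzw
      induction z using extendedPoset_cases with
      | bot =>
        induction w using extendedPoset_cases with
        | bot => simp
        | top => simp
        | coe y => simp only [extVal_coe, extVal_bot, hgx, hg0]; split_ifs <;> simp
      | top => rw [top_le_iff.1 hzw]
      | coe x =>
        induction w using extendedPoset_cases with
        | bot => exact absurd hzw (by simp)
        | top => simp
        | coe y =>
          have hxy : x ≤ y := by simpa using hzw
          simp only [extVal_coe, hgx]
          split_ifs with h1 h2
          · exact le_rfl
          · exact absurd (I.lower hxy h1) h2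
          · simp
          · simp
    | algebraMap c =>
      intro a ha
      rw [algebraMap_eq, C_apply] at ha
      rw [Finset.mem_singleton.1 (support_monomial_subset ha)]
      exact zero_mem _
    | add f g _ _ hf hg =>
      intro a ha
      rcases Finset.mem_union.1 (support_add ha) with h | h
      exacts [hf a h, hg a h]
    | mul f g _ _ hf hg =>
      intro a ha
      obtain ⟨b, hb, c, hc, rfl⟩ := Finset.mem_add.1 (support_mul f g ha)
      exact add_mem (hf b hb) (hg c hc)
  · intro h
    rw [f.as_sum]
    exact sum_mem fun a ha => monomial_mem_hibiRing (h a (mem_support_iff.1 ha)) _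

/-- The monomial of the Hibi ring with a given exponent vector and coefficient. -/
def coneMonomial {a : Option P →₀ ℕ} (ha : a ∈ hibiCone P) (c : k) : HibiRing k P :=
  ⟨monomial a c, monomial_mem_hibiRing ha c⟩

theorem hibiRing_eq_sum (f : HibiRing k P) :
    f = ∑ a ∈ f.1.support.attach,
      coneMonomial (mem_hibiRing_iff.1 f.2 a (mem_support_iff.1 a.2)) (coeff a f.1) := by
  apply Subtype.ext
  rw [AddSubmonoidClass.coe_finsetSum]
  simp only [coneMonomial]
  rw [Finset.sum_attach _ fun a => monomial a (coeff a f.1)]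
  exact f.1.as_sum

/-- Every generator of `𝔪` is divisible by `T`, so elements of `𝔪 ^ n` are divisible by `T ^ n`. -/
theorem le_of_mem_hibiMaximalIdeal_pow {n : ℕ} {f : HibiRing k P}
    (hf : f ∈ hibiMaximalIdeal k P ^ n) {a : Option P →₀ ℕ} (ha : coeff a f.1 ≠ 0) :
    n ≤ a none := by
  have h1 : hibiMaximalIdeal k P ≤ (Ideal.span {X none}).comap (HibiRing k P).val := by
    rw [hibiMaximalIdeal, Ideal.span_le]
    rintro _ ⟨I, rfl⟩
    exact Ideal.mem_span_singleton.2 (Dvd.intro _ rfl)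
  have h2 := Ideal.le_comap_pow _ n (Ideal.pow_right_mono h1 n hf)
  rw [Ideal.span_singleton_pow] at h2
  obtain ⟨g, hg⟩ := Ideal.mem_span_singleton.1 h2
  have hg' : f.1 = monomial (Finsupp.single none n) 1 * g := by
    rw [← X_pow_eq_monomial]; exact hg
  rw [hg', coeff_monomial_mul'] at ha
  by_contra hn
  refine ha (if_neg fun h => hn ?_)
  simpa using h none

end HibiRing

/-! ### Covers and maximal chains in a bounded poset -/

/-- Provides a point in the relative interior of the facet of `x ⋖ y`. It adds up indicators of
lower sets that do not separate `x` from `y`: `A` counts complements of principal upper sets, `B`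
counts sets of the form `{z | ¬ u ≤ z}` with the dual condition on `u`. -/
theorem exists_strictAnti_except_covBy {Q : Type*} [PartialOrder Q] [BoundedOrder Q] [Fintype Q]
    {x y : Q} (hxy : x ⋖ y) :
    ∃ r : Q → ℕ, Antitone r ∧ r ⊤ = 0 ∧ r x = r y ∧
      ∀ z w, z < w → ¬ (z = x ∧ w = y) → r w < r z := by
  classical
  let A : Q → Finset Q := fun z => {u | z ≤ u ∧ u ≠ ⊤ ∧ (x ≤ u → y ≤ u)}
  let B : Q → Finset Q := fun z => {u | ¬ u ≤ z ∧ (u ≤ y → u ≤ x)}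
  have hA : Antitone A := fun z w h u hu => by
    simp only [A, Finset.mem_filter, Finset.mem_univ, true_and] at hu ⊢
    exact ⟨h.trans hu.1, hu.2⟩
  have hB : Antitone B := fun z w h u hu => by
    simp only [B, Finset.mem_filter, Finset.mem_univ, true_and] at hu ⊢
    exact ⟨fun h' => hu.1 (h'.trans h), hu.2⟩
  refine ⟨fun z => (A z).card + (B z).card, fun z w h =>
    add_le_add (Finset.card_le_card (hA h)) (Finset.card_le_card (hB h)), ?_, ?_, ?_⟩
  · have h1 : A ⊤ = ∅ := by
      ext u
      simp only [A, Finset.mem_filter, Finset.mem_univ, true_and, top_le_iff, Finset.notMem_empty,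
        iff_false]
      tauto
    have h2 : B ⊤ = ∅ := by
      ext u
      simp [B]
    simp [h1, h2]
  · have h1 : A x = A y := by
      refine Finset.Subset.antisymm (fun u hu => ?_) (hA hxy.le)
      simp only [A, Finset.mem_filter, Finset.mem_univ, true_and] at hu ⊢
      exact ⟨hu.2.2 hu.1, hu.2⟩
    have h2 : B x = B y := by
      refine Finset.Subset.antisymm (fun u hu => ?_) (hB hxy.le)
      simp only [B, Finset.mem_filter, Finset.mem_univ, true_and] at hu ⊢
      exact ⟨fun h => hu.1 (hu.2 h), hu.2⟩
    simp only [h1, h2]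
  · intro z w hzw hne
    -- If `z` is admissible for `A`, it separates `z` from `w`; otherwise `x ≤ z`, and `w` does so
    -- through `B`, unless `x ≤ z < w ≤ y`.
    by_cases hz : x ≤ z → y ≤ z
    · refine add_lt_add_of_lt_of_le (Finset.card_lt_card ⟨hA hzw.le, fun h => ?_⟩)
        (Finset.card_le_card (hB hzw.le))
      have : z ∈ A z := by
        simp only [A, Finset.mem_filter, Finset.mem_univ, true_and]
        exact ⟨le_rfl, (hzw.trans_le le_top).ne, hz⟩
      have := h this
      simp only [A, Finset.mem_filter, Finset.mem_univ, true_and] at this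
      exact hzw.not_ge this.1
    · refine add_lt_add_of_le_of_lt (Finset.card_le_card (hA hzw.le))
        (Finset.card_lt_card ⟨hB hzw.le, fun h => ?_⟩)
      have : w ∈ B z := by
        simp only [B, Finset.mem_filter, Finset.mem_univ, true_and]
        refine ⟨hzw.not_ge, fun hwy => ?_⟩
        push Not at hz
        exfalso
        have hzy : z < y := hzw.trans_le hwy
        have hzx : z = x := by
          rcases hz.1.eq_or_lt with h | h
          · exact h.symm
          · exact absurd hzy (hxy.2 h)
        have hwy' : w = y := by
          rcases hwy.eq_or_lt with h | h
          · exact h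
          · exact absurd h (hxy.2 (hzx ▸ hzw))
        exact hne ⟨hzx, hwy'⟩
      have := h this
      simp only [B, Finset.mem_filter, Finset.mem_univ, true_and] at this
      exact this.1 le_rfl

/-- Neighbours in a maximal chain are covers in `Q`, so the `C.ncard - 1` steps from `⊥` to `⊤`
telescope. -/
theorem IsMaxChain.le_ncard_sub_one_mul {Q : Type*} [PartialOrder Q] [BoundedOrder Q] [Finite Q]
    {C : Set Q} (hC : IsMaxChain (· ≤ ·) C) (v : Q → ℕ) (m : ℕ) (hv : v ⊤ = 0)
    (h : ∀ x y, x ⋖ y → v x ≤ v y + m) : v ⊥ + m ≤ C.ncard * m := by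
  suffices H : ∀ z ∈ C, v ⊥ ≤ v z + {w ∈ C | w < z}.ncard * m by
    have h1 := H ⊤ hC.top_mem
    have h2 : {w ∈ C | w < ⊤}.ncard + 1 ≤ C.ncard := by
      rw [Nat.succ_le_iff]
      exact Set.ncard_lt_ncard ⟨fun w hw => hw.1, fun h => lt_irrefl _ (h hC.top_mem).2⟩
    have h3 := Nat.mul_le_mul_right m h2
    rw [add_mul] at h3
    omega
  intro z
  induction z using WellFoundedLT.induction with
  | ind z ih =>
  intro hz
  by_cases hb : z = ⊥
  · simp [hb]
  obtain ⟨y, hy⟩ := (Set.toFinite {w ∈ C | w < z}).exists_maximal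
    ⟨⊥, hC.bot_mem, bot_lt_iff_ne_bot.2 hb⟩
  have hmax : ∀ w ∈ C, w < z → w ≤ y := fun w hw hwz => by
    rcases hC.isChain.total hw hy.prop.1 with h | h
    · exact h
    · exact hy.le_of_ge ⟨hw, hwz⟩ h
  have hcov : y ⋖ z := by
    refine ⟨hy.prop.2, fun u hyu huz => ?_⟩
    have hu : IsChain (· ≤ ·) (insert u C) := hC.isChain.insert fun w hw _ => by
      rcases hC.isChain.total hw hz with h | h
      · rcases h.eq_or_lt with rfl | h
        · exact Or.inl huz.le
        · exact Or.inr ((hmax w hw h).trans hyu.le)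
      · exact Or.inl (huz.le.trans h)
    have huC : u ∈ C := by
      rw [hC.2 hu (Set.subset_insert u C)]
      exact Set.mem_insert u C
    exact (hmax u huC huz).not_gt hyu
  have h1 := ih y hy.prop.2 hy.prop.1
  have h2 := h y z hcov
  have h3 : {w ∈ C | w < y}.ncard + 1 ≤ {w ∈ C | w < z}.ncard := by
    rw [Nat.succ_le_iff]
    exact Set.ncard_lt_ncard ⟨fun w hw => ⟨hw.1, hw.2.trans hy.prop.2⟩,
      fun h => lt_irrefl _ (h hy.prop).2⟩
  have h4 := Nat.mul_le_mul_right m h3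
  rw [add_mul] at h4
  omega

/-! ### Maximal chains of `P` and of `P ∪ {-∞, ∞}` -/

section ExtendedChains

variable {P : Type*}

/-- The chain `C ∪ {-∞, ∞}`. -/
def extendChain (C : Set P) : Set (ExtendedPoset P) :=
  insert ⊥ (insert ⊤ ((fun x : P => ((x : WithTop P) : ExtendedPoset P)) '' C))

theorem coe_mem_extendChain {C : Set P} {x : P} :
    ((x : WithTop P) : ExtendedPoset P) ∈ extendChain C ↔ x ∈ C := by
  have : ((x : WithTop P) : ExtendedPoset P) ≠ ⊤ := fun h =>
    WithTop.coe_ne_top (WithBot.coe_injective h)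
  simp [extendChain, this]

theorem coe_coe_injective :
    Function.Injective fun x : P => ((x : WithTop P) : ExtendedPoset P) :=
  WithBot.coe_injective.comp WithTop.coe_injective

theorem ncard_extendChain [Finite P] (C : Set P) : (extendChain C).ncard = C.ncard + 2 := by
  rw [extendChain, Set.ncard_insert_of_notMem, Set.ncard_insert_of_notMem,
    Set.ncard_image_of_injective _ coe_coe_injective]
  · rintro ⟨x, -, h⟩
    exact WithTop.coe_ne_top (WithBot.coe_injective h)
  · rintro (h | ⟨x, -, h⟩)
    · exact WithBot.bot_ne_coe h
    · exact WithBot.coe_ne_bot h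

theorem extendChain_preimage {D : Set (ExtendedPoset P)} (hb : ⊥ ∈ D) (ht : ⊤ ∈ D) :
    extendChain ((fun x : P => ((x : WithTop P) : ExtendedPoset P)) ⁻¹' D) = D := by
  ext z
  induction z using WithBot.recBotCoe with
  | bot => simp [extendChain, hb]
  | coe z =>
    induction z using WithTop.recTopCoe with
    | top => exact iff_of_true (Or.inr (Or.inl rfl)) ht
    | coe x => exact coe_mem_extendChain

variable [PartialOrder P]

theorem isChain_extendChain {C : Set P} :
    IsChain (· ≤ ·) (extendChain C) ↔ IsChain (· ≤ ·) C := by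
  constructor
  · intro h x hx y hy _
    have := h.total (coe_mem_extendChain.2 hx) (coe_mem_extendChain.2 hy)
    simpa using this
  · intro h
    refine IsChain.insert (IsChain.insert ?_ fun _ _ _ => Or.inr le_top) fun _ _ _ => Or.inl bot_le
    rintro _ ⟨x, hx, rfl⟩ _ ⟨y, hy, rfl⟩ _
    simpa using h.total hx hy

theorem isMaxChain_extendChain {C : Set P} :
    IsMaxChain (· ≤ ·) (extendChain C) ↔ IsMaxChain (· ≤ ·) C := by
  refine ⟨fun h => ⟨isChain_extendChain.1 h.1, fun D hD hCD => ?_⟩,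
    fun h => ⟨isChain_extendChain.2 h.1, fun D hD hCD => ?_⟩⟩
  · have := h.2 (isChain_extendChain.2 hD)
      (Set.insert_subset_insert (Set.insert_subset_insert (Set.image_mono hCD)))
    ext x
    rw [← coe_mem_extendChain, this, coe_mem_extendChain]
  · have hE := extendChain_preimage (hCD (Set.mem_insert _ _))
      (hCD (Set.mem_insert_of_mem _ (Set.mem_insert _ _)))
    rw [← hE] at hD ⊢
    rw [h.2 (isChain_extendChain.1 hD) fun x hx => hCD (coe_mem_extendChain.2 hx)]

theorem maximalChainLengths_extendedPoset [Finite P] :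
    maximalChainLengths (ExtendedPoset P) = (· + 2) '' maximalChainLengths P := by
  ext l
  constructor
  · rintro ⟨D, hD, rfl⟩
    have hE := extendChain_preimage hD.bot_mem hD.top_mem
    rw [← hE] at hD ⊢
    refine ⟨_, ⟨_, isMaxChain_extendChain.1 hD, rfl⟩, ?_⟩
    rw [ncard_extendChain]
    push_cast
    ring
  · rintro ⟨_, ⟨C, hC, rfl⟩, rfl⟩
    refine ⟨_, isMaxChain_extendChain.2 hC, ?_⟩
    rw [ncard_extendChain]
    push_cast
    ring

theorem exists_isLeast_maximalChainLengths (Q : Type*) [PartialOrder Q] :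
    ∃ l, IsLeast (maximalChainLengths Q) l := by
  obtain ⟨C, hC, -⟩ := (IsChain.empty (α := Q) (r := (· ≤ ·))).exists_maxChain
  obtain ⟨l, hl, hmin⟩ := Int.exists_least_of_bdd (P := (· ∈ maximalChainLengths Q))
    ⟨-1, by rintro _ ⟨D, -, rfl⟩; omega⟩ ⟨_, C, hC, rfl⟩
  exact ⟨l, hl, hmin⟩

end ExtendedChains

/-! ### Splittings and the bound on the threshold -/

section Splitting

variable {k P : Type*} [Field k] [PartialOrder P] [Fintype P] (p : ℕ) [Fact p.Prime] [CharP k p]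

theorem rootMapSplits_iff {R : Type*} [CommRing R] {p e : ℕ} [ExpChar R p] {d : R} :
    RootMapSplits R p e d ↔
      ∃ ψ : R →+ R, (∀ r s, ψ (r ^ p ^ e * s) = r * ψ s) ∧ ψ d = 1 := by
  constructor
  · rintro ⟨φ, hφ⟩
    refine ⟨φ.toAddMonoidHom.comp (FrobeniusRoot.root R p e : R →+ FrobeniusRoot R p e),
      fun r s => φ.map_smul r (FrobeniusRoot.root R p e s), ?_⟩
    simpa using LinearMap.congr_fun hφ 1
  · rintro ⟨ψ, hψ, hd⟩
    let φ : FrobeniusRoot R p e →ₗ[R] R :=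
      { toFun := fun s => ψ ((FrobeniusRoot.root R p e).symm s)
        map_add' := fun s t => by rw [map_add, map_add]
        map_smul' := fun r s => hψ r ((FrobeniusRoot.root R p e).symm s) }
    refine ⟨φ, LinearMap.ext_ring ?_⟩
    rw [LinearMap.comp_apply, LinearMap.toSpanSingleton_apply, one_smul]
    exact hd

theorem rootMapSplits_one_of_field (k : Type*) [Field k] (p e : ℕ) [ExpChar k p] :
    RootMapSplits k p e 1 := by
  have hinj : Function.Injective
      (LinearMap.toSpanSingleton k (FrobeniusRoot k p e) (FrobeniusRoot.root k p e 1)) := by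
    have : Nontrivial (FrobeniusRoot k p e) := inferInstanceAs (Nontrivial k)
    intro a b hab
    refine (algebraMap k (FrobeniusRoot k p e)).injective ?_
    simpa [Algebra.smul_def] using hab
  exact LinearMap.exists_leftInverse_of_injective _ (LinearMap.ker_eq_bot.2 hinj)

theorem exists_coeff_eq_coeff_nsmul {σ : Type*} (τ : k →+ k) {n : ℕ} (hn : 0 < n) :
    ∃ Φ : MvPolynomial σ k →+ MvPolynomial σ k, ∀ a f, coeff a (Φ f) = τ (coeff (n • a) f) := by
  have hinj : Function.Injective fun a : σ →₀ ℕ => n • a := fun a b h => by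
    ext i
    exact Nat.eq_of_mul_eq_mul_left hn (by simpa using DFunLike.congr_fun h i)
  refine ⟨AddMonoidHom.mk' (fun f => .ofCoeff
    ((AddMonoidAlgebra.comapDomain _ hinj f).coeff.mapRange τ τ.map_zero)) fun f g => ?_,
    fun a f => ?_⟩
  · ext a
    simp [coeff]
  · simp [coeff]

/-- The Hibi ring is F-pure. -/
theorem rootMapSplits_one_hibiRing (e : ℕ) : RootMapSplits (HibiRing k P) p e 1 := by
  have hq : 0 < p ^ e := pow_pos (Fact.out : p.Prime).pos e
  -- `Φ` keeps the exponents divisible by `q`, divides them by `q`, and applies a splitting `τ` of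
  -- Frobenius on `k` to the coefficients.
  obtain ⟨τ, hτ, hτ1⟩ := rootMapSplits_iff.1 (rootMapSplits_one_of_field k p e)
  obtain ⟨Φ, hΦ⟩ := exists_coeff_eq_coeff_nsmul (σ := Option P) τ hq
  have hmem : ∀ f : HibiRing k P, Φ f.1 ∈ HibiRing k P := fun f => by
    refine mem_hibiRing_iff.2 fun a ha => ?_
    rw [hΦ] at ha
    exact mem_hibiCone_of_nsmul hq (mem_hibiRing_iff.1 f.2 _ fun h => ha (by rw [h, map_zero]))
  have hlin : ∀ g f : MvPolynomial (Option P) k, Φ (g ^ p ^ e * f) = g * Φ f := by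
    intro g f
    induction g using MvPolynomial.induction_on' with
    | add g h hg hh => rw [add_pow_expChar_pow, add_mul, map_add, hg, hh, add_mul]
    | monomial m c =>
      ext a
      rw [hΦ, monomial_pow, coeff_monomial_mul', coeff_monomial_mul', hΦ]
      have hle : p ^ e • m ≤ p ^ e • a ↔ m ≤ a := by
        simp only [Finsupp.le_def, Finsupp.smul_apply, smul_eq_mul]
        exact forall_congr' fun i => Nat.mul_le_mul_left_iff hq
      have hsub : p ^ e • a - p ^ e • m = p ^ e • (a - m) := by
        ext i
        simp [Nat.mul_sub]
      simp only [hle, hsub]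
      split_ifs
      · exact hτ c _
      · exact map_zero τ
  refine rootMapSplits_iff.2 ⟨AddMonoidHom.mk' (fun f => ⟨Φ f.1, hmem f⟩) fun f g =>
    Subtype.ext (map_add Φ f.1 g.1), fun g f => Subtype.ext (hlin g.1 f.1), Subtype.ext ?_⟩
  ext a
  change coeff a (Φ 1) = coeff a 1
  classical
  rw [hΦ, coeff_one, coeff_one]
  have : (0 = p ^ e • a) ↔ 0 = a := by
    rw [eq_comm, smul_eq_zero_iff_right hq.ne', eq_comm]
  simp only [this]
  split_ifs
  · exact hτ1
  · exact map_zero τ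

/-- A monomial on which a `q⁻¹`-linear endomorphism of the Hibi ring takes a value outside of `𝔪` is
at most `q - 1` along every facet of the cone. -/
theorem extVal_le_of_coeff_zero_ne_zero {q : ℕ} (hq : 0 < q)
    (ψ : HibiRing k P →+ HibiRing k P) (hψ : ∀ r s, ψ (r ^ q * s) = r * ψ s)
    {a : Option P →₀ ℕ} (ha : a ∈ hibiCone P) {c : k}
    (hc : coeff 0 (ψ (coneMonomial ha c)).1 ≠ 0) {x y : ExtendedPoset P} (hxy : x ⋖ y) :
    extVal a x ≤ extVal a y + (q - 1) := by
  classical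
  by_contra hlt
  have hfacet : extVal a y + q ≤ extVal a x := by omega
  have : Fintype (ExtendedPoset P) := Fintype.ofFinite _
  obtain ⟨r', hr', hr'0, hr'xy, hr'lt⟩ := exists_strictAnti_except_covBy hxy
  -- `r` lies inside the facet of `x ⋖ y`, while `s`, the indicator of `{z | z ≤ x}`, has height one
  -- above it.
  obtain ⟨r, rfl⟩ := exists_extVal_eq r' hr'0
  obtain ⟨s, hs⟩ := exists_extVal_eq (fun z => if z ≤ x then 1 else 0)
    (if_neg fun h => (hxy.lt.trans_le le_top).not_ge h)
  have hs' : ∀ z, extVal s z = if z ≤ x then 1 else 0 := congrFun hs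
  have hsC : s ∈ hibiCone P := fun z w hzw => by
    rw [hs', hs']
    split_ifs with h1 h2
    · exact le_rfl
    · exact absurd (hzw.trans h1) h2
    · simp
    · simp
  have hs1 : ∀ z, extVal s z ≤ 1 := fun z => by rw [hs']; split_ifs <;> simp
  have hsx : extVal s x = 1 := by rw [hs', if_pos le_rfl]
  have hsy : extVal s y = 0 := by rw [hs', if_neg hxy.lt.not_ge]
  -- This says that `a + q(r - s)` is order-reversing. At `(x, y)` the drop of `a` by at least `q`
  -- pays for that of `s`; elsewhere `r` drops by at least one and `s` by at most one.
  have key : ∀ z w, z < w → extVal a w + q * extVal r w + q * extVal s z ≤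
      extVal a z + q * extVal r z + q * extVal s w := by
    intro z w hzw
    by_cases h : z = x ∧ w = y
    · obtain ⟨rfl, rfl⟩ := h
      rw [hsx, hsy, hr'xy]
      omega
    · have h1 := ha hzw.le
      have h2 : extVal r w + extVal s z ≤ extVal r z + extVal s w := by
        have := hr'lt z w hzw h
        have := hs1 z
        omega
      have h3 := Nat.mul_le_mul_left q h2
      rw [mul_add, mul_add] at h3
      omega
  have hpos : ∀ z, q * extVal s z ≤ extVal a z + q * extVal r z := by
    intro z
    rcases eq_or_ne z ⊤ with rfl | hz
    · simp
    · have := key z ⊤ (lt_top_iff_ne_top.2 hz)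
      simp only [extVal_top] at this
      omega
  obtain ⟨b, hb⟩ := exists_extVal_eq
    (fun z => extVal a z + q * extVal r z - q * extVal s z) (by simp)
  have hb' : ∀ z, extVal b z = extVal a z + q * extVal r z - q * extVal s z := congrFun hb
  have hbC : b ∈ hibiCone P := fun z w hzw => by
    rcases hzw.eq_or_lt with rfl | h
    · exact le_rfl
    · have h1 := key z w h
      have h2 := hpos z
      have h3 := hpos w
      rw [hb', hb']
      omega
  have hexp : q • s + b = q • r + a := by
    apply extVal_injective
    funext z
    have := hpos z
    rw [extVal_add, extVal_add, extVal_nsmul, extVal_nsmul, hb']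
    omega
  have hmul : coneMonomial (k := k) hsC 1 ^ q * coneMonomial hbC c =
      coneMonomial (k := k) hr' 1 ^ q * coneMonomial ha c := by
    apply Subtype.ext
    change monomial s 1 ^ q * monomial b c = monomial r 1 ^ q * monomial a c
    rw [monomial_pow, monomial_pow, monomial_mul, monomial_mul, hexp]
  -- This yields `X^s ψ(cX^b) = X^r ψ(cX^a)`. At exponent `r`, the constant term of `ψ(cX^a)` equals
  -- the coefficient of `ψ(cX^b)` at `r - s`, which increases from `x` to `y` and so lies outside
  -- the cone.
  have hψmul := congrArg ψ hmul
  rw [hψ, hψ] at hψmul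
  have hcoeff : coeff r (monomial s 1 * (ψ (coneMonomial hbC c)).1) =
      coeff r (monomial r 1 * (ψ (coneMonomial ha c)).1) :=
    congrArg (fun f : HibiRing k P => coeff r f.1) hψmul
  rw [coeff_monomial_mul', coeff_monomial_mul', if_pos le_rfl, tsub_self, one_mul, one_mul]
    at hcoeff
  split_ifs at hcoeff with hsr
  · rw [← hcoeff] at hc
    have hmem := mem_hibiRing_iff.1 (ψ (coneMonomial hbC c)).2 _ hc hxy.le
    have hadd : ∀ z, extVal r z = extVal (r - s) z + extVal s z := fun z => by
      rw [← extVal_add, tsub_add_cancel_of_le hsr]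
    have h1 := hadd x
    have h2 := hadd y
    omega
  · exact hc hcoeff.symm

theorem le_of_rootMapSplits {e n : ℕ} {d : HibiRing k P} (hd : d ∈ hibiMaximalIdeal k P ^ n)
    (hsplit : RootMapSplits (HibiRing k P) p e d) {C : Set (ExtendedPoset P)}
    (hC : IsMaxChain (· ≤ ·) C) : n + (p ^ e - 1) ≤ C.ncard * (p ^ e - 1) := by
  obtain ⟨ψ, hψ, hψd⟩ := rootMapSplits_iff.1 hsplit
  have h0 : coeff 0 (ψ d).1 ≠ 0 := by
    rw [hψd]
    simp
  rw [hibiRing_eq_sum d, map_sum, AddSubmonoidClass.coe_finsetSum, coeff_sum] at h0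
  obtain ⟨a, -, ha⟩ := Finset.exists_ne_zero_of_sum_ne_zero h0
  have h1 := le_of_mem_hibiMaximalIdeal_pow hd (mem_support_iff.1 a.2)
  have h2 := hC.le_ncard_sub_one_mul (extVal a.1) (p ^ e - 1) (extVal_top _) fun x y hxy =>
    extVal_le_of_coeff_zero_ne_zero (pow_pos (Fact.out : p.Prime).pos e) ψ hψ _ ha hxy
  rw [extVal_bot] at h2
  omega

theorem zero_mem_fPureExponents : 0 ∈ fPureExponents p (hibiMaximalIdeal k P) :=
  ⟨le_rfl, 0, fun e _ => ⟨1, by simp, rootMapSplits_one_hibiRing p e⟩⟩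

theorem fPureExponents_le {t : ℝ} (ht : t ∈ fPureExponents p (hibiMaximalIdeal k P)) {l : ℤ}
    (hl : l ∈ maximalChainLengths (ExtendedPoset P)) : t ≤ l := by
  obtain ⟨C, hC, rfl⟩ := hl
  obtain ⟨-, e₀, he₀⟩ := ht
  -- A single exponent suffices; `e₀ + 1` ensures `q > 1`, so that `q - 1` can be cancelled.
  obtain ⟨d, hd, hsplit⟩ := he₀ (e₀ + 1) (Nat.le_succ _)
  have h1 : 1 < p ^ (e₀ + 1) := Nat.one_lt_pow (Nat.succ_ne_zero _) (Fact.out : p.Prime).one_lt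
  have h2 := le_of_rootMapSplits p hd hsplit hC
  have h3 := Nat.le_ceil (t * ((p : ℝ) ^ (e₀ + 1) - 1))
  have h4 : (1 : ℝ) < (p : ℝ) ^ (e₀ + 1) := mod_cast h1
  have h5 := (Nat.cast_le (α := ℝ)).2 h2
  rw [Nat.cast_add, Nat.cast_mul, Nat.cast_sub h1.le, Nat.cast_pow, Nat.cast_one] at h5
  have h6 : t * ((p : ℝ) ^ (e₀ + 1) - 1) ≤ (C.ncard - 1) * ((p : ℝ) ^ (e₀ + 1) - 1) := by
    linarith
  push_cast
  exact le_of_mul_le_mul_right h6 (by linarith)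

end Splitting

end

theorem corollary3p8 (k : Type*) [Field k] (p : ℕ) [Fact p.Prime] [CharP k p]
    (P : Type*) [PartialOrder P] [Fintype P] :
    IsLUB (fPureExponents p (hibiMaximalIdeal k P)) (fpt p (hibiMaximalIdeal k P)) ∧
    ∃ l l' : ℤ,
      IsLeast (maximalChainLengths (ExtendedPoset P)) l ∧
      IsLeast (maximalChainLengths P) l' ∧
      fpt p (hibiMaximalIdeal k P) ≤ (l : ℝ) ∧
      l = l' + 2 := by
  obtain ⟨l', hl'⟩ := exists_isLeast_maximalChainLengths P
  have hl : IsLeast (maximalChainLengths (ExtendedPoset P)) (l' + 2) := by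
    rw [maximalChainLengths_extendedPoset]
    refine ⟨⟨l', hl'.1, rfl⟩, ?_⟩
    rintro _ ⟨m, hm, rfl⟩
    exact add_le_add_left (hl'.2 hm) 2
  have hne : (fPureExponents p (hibiMaximalIdeal k P)).Nonempty := ⟨0, zero_mem_fPureExponents p⟩
  have hle : ∀ t ∈ fPureExponents p (hibiMaximalIdeal k P), t ≤ ((l' + 2 : ℤ) : ℝ) :=
    fun t ht => fPureExponents_le p ht hl.1
  exact ⟨isLUB_csSup hne ⟨_, hle⟩, l' + 2, l', hl, hl', csSup_le hne hle, rfl⟩
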